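/- **Theorem 2.4.** For $\alpha\in\mathbb R$ let $\Vert\alpha\Vert$ be the distance of $\alpha$ to the nearest integer. For an integer $m\ge 1$ and a real $\lambda>0$ let $\mathscr H^m_\lambda$ be the set of all $(\zeta_1,\dots,\zeta_m)\in\mathbb R^m$ such that, for every $\epsilon>0$, the inequality $\max_{1\le j\le m}\Vert q\zeta_j\Vert\le q^{-\lambda+\epsilon}$ holds for infinitely many positive integers $q$. Let $k\ge 1$ be an integer and let $P_1,\dots,P_k\in\mathbb Q[X]$ with $P_1(X)=X$ have degrees $1=d_1\le d_2\le\dots\le d_k$. Let $\mathscr C=\{(P_1(x),\dots,P_k(x)):x\in\mathbb R\}\subseteq\mathbb R^k$, and suppose that $t\ge 1$, where $t=\max_{1\le j\le k-1}(d_{j+1}-d_j)$ (and $t=0$ if $k=1$). Let $\Pi_1:\mathbb R^k\to\mathbb R$ be the projection to the first coordinate. Let $\tau\ge 1/k$ be real, and let $r=r(\tau)$ be the smallest index $r\in\{1,\dots,k-1\}$ with $d_{r+1}-d_r>\tau$, and $r=k$ if there is no such index. Then for every real $\lambda>\tau$, $$\mathscr H^1_{d_k\lambda+d_k-1}\subseteq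 \Pi_1(\mathscr C\cap\mathscr H^k_\lambda)\subseteq \mathscr H^1_{d_r\lambda+d_r-1},$$ and hence, with $\dim$ denoting Hausdorff dimension, $$\frac{2}{d_k(1+\lambda)}\le \dim(\mathscr C\cap\mathscr H^k_\lambda)\le \frac{2}{d_r(1+\lambda)}.$$ -/

import Mathlib

open Polynomial

/-- The distance of a real number to the nearest integer. -/
noncomputable def distInt (x : ℝ) : ℝ := |x - round x|

/-- The set of points of `ℝ^k` such that, for every `ε > 0`, there are infinitely many positive
integers `q` with `max_j ‖q ζ_j‖ ≤ q ^ (-lam + ε)`. -/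
def approxSet (k : ℕ) (lam : ℝ) : Set (EuclideanSpace ℝ (Fin k)) :=
  {ζ | ∀ ε : ℝ, 0 < ε →
    {q : ℕ | 0 < q ∧ ∀ j : Fin k, distInt ((q : ℝ) * ζ j) ≤ (q : ℝ) ^ (-lam + ε)}.Infinite}

/-- The polynomial curve `{(P_1(x), …, P_k(x)) : x ∈ ℝ}`; the polynomial `P_j` is `P (j - 1)`. -/
noncomputable def polyCurve {k : ℕ} (P : Fin k → ℚ[X]) : Set (EuclideanSpace ℝ (Fin k)) :=
  Set.range fun x : ℝ => WithLp.toLp 2 fun j : Fin k => aeval x (P j)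

/-- The projection of `ℝ^k` to `ℝ^s` on the first `s` coordinates. -/
noncomputable def projFirst {s k : ℕ} (h : s ≤ k) (ζ : EuclideanSpace ℝ (Fin k)) :
    EuclideanSpace ℝ (Fin s) :=
  WithLp.toLp 2 fun j : Fin s => ζ (Fin.castLE h j)

/-- The largest jump `d_{j+1} - d_j`, `1 ≤ j ≤ k - 1`, of a (nondecreasing) tuple;
it is `0` if `k = 1`. -/
def tupleDiameter {k : ℕ} (d : Fin k → ℕ) : ℕ :=
  Finset.univ.sup fun j : Fin (k - 1) =>
    d ⟨(j : ℕ) + 1, by have := j.isLt; omega⟩ - d ⟨(j : ℕ), by have := j.isLt; omega⟩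

/-- The positions `j` that are not the last one and where the jump from `d j` to the next entry
exceeds `τ`. -/
def bigJumps {k : ℕ} (d : Fin k → ℕ) (τ : ℝ) : Set (Fin k) :=
  {j | ∃ h : (j : ℕ) + 1 < k, τ < (d ⟨(j : ℕ) + 1, h⟩ : ℝ) - (d j : ℝ)}

/-- `r` is the smallest position of a jump exceeding `τ`, or the last position if there is no such
jump. (Positions are counted from `0`.) -/
def IsFirstBigJump {k : ℕ} (d : Fin k → ℕ) (τ : ℝ) (r : Fin k) : Prop :=
  IsLeast (bigJumps d τ) r ∨ (bigJumps d τ = ∅ ∧ (r : ℕ) + 1 = k)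

/-! Left inclusion: let a fraction `v` with denominator dividing `b` satisfy `|x - v| ≤ b ^ (-d_k (1
+ λ))` up to `b ^ δ`. If `E` clears the denominators of all the `P_j`, then `q = E b ^ d_k` makes
every `q P_j(v)` an integer, and `q P_j(x)` differs from it by about `q ^ (-λ)`.

Right inclusion: let `q` be good for `(P_j(x))`, and let `v = round (q x) / q` have reduced
denominator `b`. By induction on `j ≤ r`, `b ^ d_j` divides `C q` with `C` independent of `q`
(`exists_den_pow_dvd`). Indeed `q P_{j+1}(v)` is within `O(q ^ (-λ + ε))` of an integer, and
multiplying it by a constant and by `b ^ (d_{j+1} - d_j) ≤ q ^ τ` makes it an integer. Since `λ - ε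
> τ`, the multiplied error is an integer smaller than 1, hence zero. The resulting divisibility,
with the numerator of `v` coprime to `b`, yields the next power of `b`. Finally `b ^ d_r ≤ C q`
turns `|x - v| ≤ q ^ (-1 - λ + ε)` into approximation of `x` to order `d_r (1 + λ) - 1`.

The dimension bounds follow from the Jarník–Besicovitch theorem `dim = 2 / (1 + w)`, because neither
the projection nor the polynomial parametrisation raises dimension. Its lower bound
(`le_dimH_approxLine`) comes from a Cantor set built around evenly spread rationals, its upper bound
(`dimH_approxLine_le`) from the obvious cover by balls around fractions. -/

/-! ### Rationals with large denominators in an interval -/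

open MeasureTheory Filter in
/-- Every interval of length `ℓ` contains a positive proportion of the expected number of rationals
with denominator comparable to `Q`, for `Q` large in terms of `ℓ` only. -/
theorem exists_finset_rat_den_le {ℓ : ℝ} (hℓ : 0 < ℓ) : ∀ᶠ Q : ℕ in atTop, ∀ a : ℝ,
    ∃ S : Finset ℚ, (∀ v ∈ S, a ≤ v ∧ (v : ℝ) ≤ a + ℓ ∧ Q ≤ 16 * v.den ∧ v.den ≤ Q) ∧
      ℓ * Q ^ 2 / 128 ≤ S.card := by
  -- The harmonic sum is `o(Q)`; this absorbs the contribution of the `+ 1` in `hA` to `hsum`.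
  have hces : ∀ᶠ Q : ℕ in atTop,
      (Q : ℝ)⁻¹ * ∑ i ∈ Finset.range Q, (1 / ((i : ℝ) + 1)) < ℓ / 16 :=
    (tendsto_one_div_add_atTop_nhds_zero_nat (𝕜 := ℝ)).cesaro.eventually_lt_const (by positivity)
  have hlarge : ∀ᶠ Q : ℕ in atTop, 4 / ℓ < (Q : ℝ) :=
    tendsto_natCast_atTop_atTop.eventually_gt_atTop _
  filter_upwards [hces, hlarge, eventually_gt_atTop 0] with Q hces hQℓ hQ a
  have hQ' : (0 : ℝ) < Q := by exact_mod_cast hQ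
  let A : ℕ → Finset ℚ := fun q =>
    (Finset.Icc ⌈q * a⌉ ⌊q * (a + ℓ)⌋).image fun p : ℤ => (p : ℚ) / q
  have hA : ∀ q : ℕ, ((A q).card : ℝ) ≤ q * ℓ + 1 := by
    intro q
    refine (Nat.cast_le.2 Finset.card_image_le).trans ?_
    rw [Int.card_Icc, ← Int.cast_natCast, Int.toNat_eq_max, Int.cast_max]
    have h1 := Int.floor_le ((q : ℝ) * (a + ℓ))
    have h2 := Int.le_ceil ((q : ℝ) * a)
    have h3 : (0 : ℝ) ≤ q * ℓ := by positivity
    push_cast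
    refine max_le ?_ (by linarith)
    nlinarith
  have hmem : ∀ v : ℚ, a ≤ v → (v : ℝ) ≤ a + ℓ → v ∈ A v.den := by
    intro v h1 h2
    have hd : (0 : ℝ) < v.den := by exact_mod_cast v.pos
    have hv : (v : ℝ) * v.den = v.num := by exact_mod_cast v.mul_den_eq_num
    refine Finset.mem_image.2 ⟨v.num, Finset.mem_Icc.2 ⟨?_, ?_⟩, v.num_div_den⟩
    · rw [Int.ceil_le, ← hv, mul_comm]; gcongr
    · rw [Int.le_floor, ← hv, mul_comm]; gcongr
  let S : Finset ℚ := ((Finset.Icc 1 Q).biUnion A).filter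
    fun v => a ≤ v ∧ (v : ℝ) ≤ a + ℓ ∧ Q ≤ 16 * v.den ∧ v.den ≤ Q
  refine ⟨S, fun v hv => (Finset.mem_filter.1 hv).2, ?_⟩
  -- Dirichlet's theorem covers the middle half of the interval by balls around rationals that stay
  -- inside the whole. Denominators up to `Q / 16` account for measure at most `ℓ / 4` of the
  -- required `ℓ / 2`, so the larger ones, with balls of radius at most `16 / Q ^ 2`, must be
  -- numerous.
  have hcover : Set.Icc (a + ℓ / 4) (a + 3 * ℓ / 4) ⊆
      (⋃ v ∈ S, Metric.closedBall (v : ℝ) (16 / Q ^ 2)) ∪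
      ⋃ q ∈ Finset.Icc 1 (Q / 16), ⋃ v ∈ A q, Metric.closedBall (v : ℝ) (1 / (Q * q)) := by
    rintro x ⟨hx1, hx2⟩
    obtain ⟨v, hv, hvQ⟩ := Real.exists_rat_abs_sub_le_and_den_le x hQ
    have hd : (1 : ℝ) ≤ v.den := by exact_mod_cast v.pos
    have hv1 : |x - v| ≤ 1 / (Q * v.den) := hv.trans (by gcongr; linarith)
    have hv2 : |x - v| ≤ ℓ / 4 := by
      refine hv1.trans ?_
      rw [div_lt_iff₀ hℓ] at hQℓ
      rw [div_le_div_iff₀ (by positivity) (by norm_num)]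
      nlinarith [mul_le_mul_of_nonneg_left hd (by positivity : (0:ℝ) ≤ ℓ * Q)]
    rw [abs_le] at hv2
    have ha1 : a ≤ v := by linarith
    have ha2 : (v : ℝ) ≤ a + ℓ := by linarith
    by_cases hs : v.den ≤ Q / 16
    · refine Or.inr ?_
      simp only [Set.mem_iUnion]
      exact ⟨v.den, Finset.mem_Icc.2 ⟨v.pos, hs⟩, v, hmem v ha1 ha2, hv1⟩
    · refine Or.inl ?_
      have hs' : Q ≤ 16 * v.den := by omega
      simp only [Set.mem_iUnion]
      refine ⟨v, Finset.mem_filter.2 ⟨Finset.mem_biUnion.2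
        ⟨v.den, Finset.mem_Icc.2 ⟨v.pos, hvQ⟩, hmem v ha1 ha2⟩, ha1, ha2, hs', hvQ⟩, ?_⟩
      refine hv1.trans ?_
      have : (Q : ℝ) ≤ 16 * v.den := by exact_mod_cast hs'
      rw [div_le_div_iff₀ (by positivity) (by positivity)]
      nlinarith
  have hvol : ℓ / 2 ≤ S.card * (32 / Q ^ 2) +
      ∑ q ∈ Finset.Icc 1 (Q / 16), ((A q).card : ℝ) * (2 / (Q * q)) := by
    have hne : volume ((⋃ v ∈ S, Metric.closedBall (v : ℝ) (16 / Q ^ 2)) ∪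
        ⋃ q ∈ Finset.Icc 1 (Q / 16), ⋃ v ∈ A q, Metric.closedBall (v : ℝ) (1 / (Q * q))) ≠ ⊤ := by
      refine (measure_union_lt_top ?_ ?_).ne
      · exact measure_biUnion_lt_top S.finite_toSet fun v _ => measure_closedBall_lt_top
      · exact measure_biUnion_lt_top (Finset.finite_toSet _) fun q _ =>
          measure_biUnion_lt_top (Finset.finite_toSet _) fun v _ => measure_closedBall_lt_top
    have h := (measureReal_mono (μ := volume) hcover hne).trans (measureReal_union_le _ _)
    rw [Real.volume_real_Icc_of_le (by linarith)] at h
    calc ℓ / 2 = a + 3 * ℓ / 4 - (a + ℓ / 4) := by ring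
      _ ≤ _ := h
      _ ≤ _ := by
        refine add_le_add ((measureReal_biUnion_finset_le _ _).trans ?_)
          ((measureReal_biUnion_finset_le _ _).trans (Finset.sum_le_sum fun q _ =>
            (measureReal_biUnion_finset_le _ _).trans ?_))
        · simp_rw [Real.volume_real_closedBall (by positivity : (0:ℝ) ≤ 16 / Q ^ 2)]
          rw [Finset.sum_const, nsmul_eq_mul]
          apply le_of_eq; ring
        · simp_rw [Real.volume_real_closedBall (by positivity : (0:ℝ) ≤ 1 / (Q * q))]
          rw [Finset.sum_const, nsmul_eq_mul]
          apply le_of_eq; ring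
  have hsum : ∑ q ∈ Finset.Icc 1 (Q / 16), ((A q).card : ℝ) * (2 / (Q * q)) ≤ ℓ / 4 := by
    have h1 : ∀ q ∈ Finset.Icc 1 (Q / 16), ((A q).card : ℝ) * (2 / (Q * q)) ≤
        2 * ℓ / Q + 2 * (Q : ℝ)⁻¹ * (1 / q) := by
      intro q hq
      have hq1 : (0 : ℝ) < q := by exact_mod_cast (Finset.mem_Icc.1 hq).1
      refine (mul_le_mul_of_nonneg_right (hA q) (by positivity)).trans (le_of_eq ?_)
      field_simp
    refine (Finset.sum_le_sum h1).trans ?_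
    rw [Finset.sum_add_distrib, ← Finset.mul_sum, Finset.sum_const, Nat.card_Icc, nsmul_eq_mul]
    have h2 : ∑ q ∈ Finset.Icc 1 (Q / 16), (1 / (q : ℝ)) ≤
        ∑ i ∈ Finset.range Q, (1 / ((i : ℝ) + 1)) := by
      calc ∑ q ∈ Finset.Icc 1 (Q / 16), (1 / (q : ℝ)) ≤ ∑ q ∈ Finset.Icc 1 Q, (1 / (q : ℝ)) :=
            Finset.sum_le_sum_of_subset_of_nonneg
              (Finset.Icc_subset_Icc_right (Nat.div_le_self _ _)) fun _ _ _ => by positivity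
        _ = ∑ i ∈ Finset.range Q, (1 / ((i : ℝ) + 1)) :=
            (Finset.sum_nbij' (· + 1) (· - 1) (by intro i hi; simp at hi ⊢; omega)
              (by intro i hi; simp at hi ⊢; omega) (by simp)
              (by simp; omega) (by simp)).symm
    have h3 : (((Q / 16 + 1 - 1 : ℕ)) : ℝ) ≤ Q / 16 := by
      rw [Nat.add_sub_cancel]; exact_mod_cast Nat.cast_div_le
    have h4 : (((Q / 16 + 1 - 1 : ℕ)) : ℝ) * (2 * ℓ / Q) ≤ ℓ / 8 := by
      refine (mul_le_mul_of_nonneg_right h3 (by positivity)).trans (le_of_eq ?_)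
      field_simp; norm_num
    have h5 := mul_le_mul_of_nonneg_left h2 (by positivity : (0:ℝ) ≤ 2 * (Q : ℝ)⁻¹)
    linarith
  have h : ℓ / 4 ≤ S.card * (32 / Q ^ 2) := by linarith
  rw [mul_div_assoc', le_div_iff₀ (by positivity)] at h
  linarith

/-! ### Approximation order on the line and spacing of rationals -/

/-- The points of the line that are approximable by rationals to the order `lam`. -/
def approxLine (lam : ℝ) : Set ℝ :=
  {x | ∀ ε : ℝ, 0 < ε → {q : ℕ | 0 < q ∧ distInt ((q : ℝ) * x) ≤ (q : ℝ) ^ (-lam + ε)}.Infinite}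

theorem distInt_le_abs_sub (x : ℝ) (z : ℤ) : distInt x ≤ |x - z| := round_le x z

theorem one_div_sq_le_sub_of_den_le {v v' : ℚ} {Q : ℕ} (h : v < v') (hv : v.den ≤ Q)
    (hv' : v'.den ≤ Q) : 1 / (Q : ℝ) ^ 2 ≤ (v' : ℝ) - v := by
  have h1 : (0 : ℝ) < v.den := by exact_mod_cast v.pos
  have h2 : (0 : ℝ) < v'.den := by exact_mod_cast v'.pos
  have e1 : (v : ℝ) * v.den = v.num := by exact_mod_cast v.mul_den_eq_num
  have e2 : (v' : ℝ) * v'.den = v'.num := by exact_mod_cast v'.mul_den_eq_num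
  have h3 : (1 : ℝ) ≤ v'.num * v.den - v.num * v'.den := by
    have : v.num * v'.den < v'.num * v.den := Rat.lt_iff v v' |>.1 h
    exact_mod_cast (by omega : (1 : ℤ) ≤ v'.num * v.den - v.num * v'.den)
  have h4 : (v.den : ℝ) * v'.den ≤ Q ^ 2 := by
    rw [sq]; gcongr
  have h5 : (1 : ℝ) ≤ (v' - v) * (v.den * v'.den) := by
    rw [← e1, ← e2] at h3; linarith
  have h6 : (0 : ℝ) < v' - v := by exact_mod_cast sub_pos.2 h
  rw [div_le_iff₀ (by nlinarith)]
  nlinarith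

/-- In increasing order, consecutive elements differ by at least `1 / Q ^ 2`, and these gaps add up.
The value 0 from `M` on is a dummy. -/
theorem exists_spaced_enumeration {S : Finset ℚ} {Q M : ℕ} (hS : ∀ v ∈ S, v.den ≤ Q)
    (hM : M ≤ S.card) : ∃ g : ℕ → ℚ, (∀ m < M, g m ∈ S) ∧
      ∀ m m', m ≤ m' → m' < M → ((m' : ℝ) - m) / Q ^ 2 ≤ (g m' : ℝ) - g m := by
  let o := S.orderEmbOfCardLe hM
  have ho : ∀ m : Fin M, o m ∈ S := S.orderEmbOfCardLe_mem hM
  refine ⟨fun m => if h : m < M then o ⟨m, h⟩ else 0, fun m hm => by simp [hm, ho], ?_⟩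
  intro m m' hmm
  induction m', hmm using Nat.le_induction with
  | base => intro _; simp
  | succ n hn ih =>
    intro h
    have hn' : n < M := by omega
    have h1 := ih hn'
    have h2 := one_div_sq_le_sub_of_den_le
      (o.strictMono (show (⟨n, hn'⟩ : Fin M) < ⟨n + 1, h⟩ from Nat.lt_succ_self n))
      (hS _ (ho _)) (hS _ (ho _))
    simp only [h, hn', dif_pos] at h1 ⊢
    push_cast
    rw [show ((n : ℝ) + 1 - m) / (Q : ℝ) ^ 2 = (n - m) / Q ^ 2 + 1 / Q ^ 2 by ring]
    linarith

/-! ### Jarník–Besicovitch, lower bound: the Cantor construction -/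

/-- A finite stage of a Cantor construction: intervals `[f i, f i + ρ]`, `i < N`, whose gaps are
bounded below so that the limit parametrisation expands distances at least like `t ↦ t ^ u`. -/
structure CantorStage (u : ℝ) where
  N : ℕ
  ρ : ℝ
  f : ℕ → ℝ
  N_pos : 0 < N
  ρ_pos : 0 < ρ
  -- The `+ 1` is there because parameters in cells `i < j` of length `1 / N` can be almost `(j - i
  -- + 1) / N` apart.
  sep : ∀ i j, i < j → j < N → f i + ρ + (((j : ℝ) - i + 1) / N) ^ u ≤ f j
  -- This makes the gaps required inside one interval small enough for the next refinement.
  large : 1024 ≤ (N : ℝ) ^ u * ρ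

/-- `B` refines `A`, and its intervals start at rationals with denominator at least `T` which
approximate all the points of the interval to the order `w`. -/
def CantorStage.IsRefinement {u : ℝ} (w : ℝ) (T : ℕ) (A B : CantorStage u) : Prop :=
  ∃ M : ℕ, 2 ≤ M ∧ B.N = A.N * M ∧ ∀ j < B.N,
    A.f (j / M) ≤ B.f j ∧ B.f j + B.ρ ≤ A.f (j / M) + A.ρ ∧
    ∃ v : ℚ, B.f j = v ∧ T ≤ v.den ∧ B.ρ ≤ (v.den : ℝ) ^ (-(1 + w))

-- Each parent receives about `ρ Q ^ 2 / 256` children of length `Q ^ (-(1 + w))`, starting at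
-- rationals spaced by `1 / Q ^ 2`. The condition `1 < w` makes the children much shorter than this
-- spacing, and `1 + w < 2 * u` makes `large` hold again for big `Q`.
open Filter Topology in
theorem CantorStage.exists_isRefinement {u w : ℝ} (hw : 1 < w) (hu : 1 + w < 2 * u) (T : ℕ)
    (A : CantorStage u) : ∃ B : CantorStage u, A.IsRefinement w T B := by
  have hρ := A.ρ_pos
  have hNpos : (0 : ℝ) < A.N := by exact_mod_cast A.N_pos
  have hcast := tendsto_natCast_atTop_atTop (R := ℝ)
  -- Rationals are taken from the left half of the parent, so that children of length at most `ρ /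
  -- 2` (`E3`) fit inside.
  have E1 := exists_finset_rat_den_le (half_pos hρ)
  have E2 : ∀ᶠ Q : ℕ in atTop, (2 : ℝ) ≤ (Q : ℝ) ^ (w - 1) :=
    ((tendsto_rpow_atTop (by linarith : 0 < w - 1)).comp hcast).eventually_ge_atTop 2
  have E3 : ∀ᶠ Q : ℕ in atTop, (Q : ℝ) ^ (-(1 + w)) ≤ A.ρ / 2 :=
    ((tendsto_rpow_neg_atTop (by linarith : 0 < 1 + w)).comp hcast).eventually_le_const
      (by positivity)
  have E4 : ∀ᶠ Q : ℕ in atTop, 1 < A.ρ / 256 * (Q : ℝ) ^ 2 :=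
    (((tendsto_pow_atTop two_ne_zero).comp hcast).const_mul_atTop
      (by positivity : 0 < A.ρ / 256)).eventually_gt_atTop 1
  have E5 : ∀ᶠ Q : ℕ in atTop, 1024 ≤ (A.ρ / 256) ^ u * (Q : ℝ) ^ (2 * u - (1 + w)) :=
    (((tendsto_rpow_atTop (by linarith : 0 < 2 * u - (1 + w))).comp hcast).const_mul_atTop
      (by positivity : 0 < (A.ρ / 256) ^ u)).eventually_ge_atTop 1024
  obtain ⟨Q, hQ1, hQ2, hQ3, hQ4, hQ5, hQT, hQ0⟩ := (E1.and (E2.and (E3.and (E4.and (E5.and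
    ((eventually_ge_atTop (16 * T)).and (eventually_gt_atTop 0))))))).exists
  have hQ : (0 : ℝ) < Q := by exact_mod_cast hQ0
  choose S hS hcard using hQ1
  set M := ⌈A.ρ / 256 * (Q : ℝ) ^ 2⌉₊ with hMdef
  have hM : A.ρ / 256 * (Q : ℝ) ^ 2 ≤ M := Nat.le_ceil _
  have hM2 : 2 ≤ M := by
    have : (1 : ℝ) < M := hQ4.trans_le hM
    exact_mod_cast this
  have hM0 : 0 < M := by omega
  have hMr : (0 : ℝ) < M := by exact_mod_cast hM0
  have hMS : ∀ a, M ≤ (S a).card := fun a => Nat.ceil_le.2 (by linarith [hcard a])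
  choose g hg hgs using fun a => exists_spaced_enumeration (fun v hv => (hS a v hv).2.2.2) (hMS a)
  set ρ' := (Q : ℝ) ^ (-(1 + w)) with hρ'
  have hρ'_pos : 0 < ρ' := by positivity
  have hρ'_le : ρ' ≤ 1 / (2 * Q ^ 2) := by
    have : (Q : ℝ) ^ (w - 1) * Q ^ 2 = Q ^ (1 + w) := by
      rw [← Real.rpow_natCast, ← Real.rpow_add hQ]; norm_num; ring_nf
    rw [hρ', Real.rpow_neg hQ.le, ← one_div, ← this]
    gcongr
  have hu1 : 1 ≤ u := by linarith
  let f' : ℕ → ℝ := fun j => g (A.f (j / M)) (j % M)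
  have hmod : ∀ j, j % M < M := fun j => Nat.mod_lt _ hM0
  have hlow : ∀ j, A.f (j / M) ≤ f' j := fun j => (hS _ _ (hg _ _ (hmod j))).1
  have hup : ∀ j, f' j + ρ' ≤ A.f (j / M) + A.ρ := fun j => by
    have := (hS _ _ (hg (A.f (j / M)) _ (hmod j))).2.1
    simp only [f']; linarith
  have hsep : ∀ i j, i < j → j < A.N * M →
      f' i + ρ' + (((j : ℝ) - i + 1) / (A.N * M : ℕ)) ^ u ≤ f' j := by
    intro i j hij hj
    have hij' : (0 : ℝ) ≤ (j : ℝ) - i := sub_nonneg.2 (by exact_mod_cast hij.le)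
    have hIJ : i / M ≤ j / M := Nat.div_le_div_right hij.le
    have hi : M * (i / M) + i % M = i := Nat.div_add_mod i M
    have hj' : M * (j / M) + j % M = j := Nat.div_add_mod j M
    have hir : (M : ℝ) * (i / M : ℕ) + (i % M : ℕ) = i := by exact_mod_cast hi
    have hjr : (M : ℝ) * (j / M : ℕ) + (j % M : ℕ) = j := by exact_mod_cast hj'
    rcases hIJ.lt_or_eq with hlt | heq
    -- Different parents: their separation suffices, as `j - i + 1 ≤ (J - I + 1) * M` for the parent
    -- indices `I`, `J`.
    · have h1 := A.sep _ _ hlt (Nat.div_lt_of_lt_mul (by rwa [mul_comm]))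
      have h2 : (((j : ℝ) - i + 1) / (A.N * M : ℕ)) ^ u ≤
          ((((j / M : ℕ) : ℝ) - (i / M : ℕ) + 1) / A.N) ^ u := by
        refine Real.rpow_le_rpow (by positivity) ?_ (by linarith)
        push_cast
        rw [div_le_div_iff₀ (by positivity) hNpos]
        have h3 : ((j % M : ℕ) : ℝ) + 1 ≤ M := by exact_mod_cast hmod j
        have h4 : (0 : ℝ) ≤ (i % M : ℕ) := by positivity
        have h5 : (j : ℝ) - i + 1 ≤ (((j / M : ℕ) : ℝ) - (i / M : ℕ) + 1) * M := by
          rw [← hir, ← hjr]; linarith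
        nlinarith
      linarith [hlow j, hup i]
    -- Same parent: of the distance `(j - i) / Q ^ 2` between the rationals, one half pays for the
    -- child's length and the other for the required gap, which `large` bounds by `(j - i + 1) / (4
    -- * Q ^ 2)`.
    · have hmul : M * (i / M) = M * (j / M) := by rw [heq]
      have h1 := hgs (A.f (i / M)) (i % M) (j % M) (by omega) (hmod j)
      have h2 : f' j - f' i ≥ ((j : ℝ) - i) / Q ^ 2 := by
        simp only [f', ← heq]
        rw [← heq] at hjr
        rw [← hir, ← hjr]
        refine le_trans (le_of_eq ?_) h1
        ring
      have hji1 : (1 : ℝ) ≤ (j : ℝ) - i := by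
        have : (i : ℝ) + 1 ≤ j := by exact_mod_cast hij
        linarith
      have hjiM : (j : ℝ) - i + 1 ≤ M := by
        have : j + 1 ≤ M + i := by rw [← heq] at hj'; have := hmod j; omega
        have : (j : ℝ) + 1 ≤ M + i := by exact_mod_cast this
        linarith
      have h3 : (((j : ℝ) - i + 1) / (A.N * M : ℕ)) ^ u ≤ ((j : ℝ) - i + 1) / (4 * Q ^ 2) := by
        have h4 : (((j : ℝ) - i + 1) / M) ^ u ≤ ((j : ℝ) - i + 1) / M := by
          have := Real.rpow_le_rpow_of_exponent_ge (x := ((j : ℝ) - i + 1) / M) (by positivity)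
            (by rw [div_le_one hMr]; exact hjiM) hu1
          simpa using this
        have h5 : ((A.N : ℝ) ^ u)⁻¹ ≤ A.ρ / 1024 := by
          rw [inv_le_iff_one_le_mul₀ (by positivity)]
          linarith [A.large]
        have h6 : ((j : ℝ) - i + 1) / (A.N * M : ℕ) = ((j : ℝ) - i + 1) / M * (A.N : ℝ)⁻¹ := by
          push_cast; field_simp
        rw [h6, Real.mul_rpow (by positivity) (by positivity), Real.inv_rpow hNpos.le]
        calc _ ≤ ((j : ℝ) - i + 1) / M * (A.ρ / 1024) := by gcongr
          _ ≤ ((j : ℝ) - i + 1) / (A.ρ / 256 * (Q : ℝ) ^ 2) * (A.ρ / 1024) := by gcongr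
          _ = _ := by field_simp; norm_num
      have h7 : ((j : ℝ) - i + 1) / (4 * Q ^ 2) ≤ ((j : ℝ) - i) / (2 * Q ^ 2) := by
        rw [div_le_div_iff₀ (by positivity) (by positivity)]
        nlinarith [sq_nonneg (Q : ℝ)]
      have h8 : (1 : ℝ) / (2 * Q ^ 2) ≤ ((j : ℝ) - i) / (2 * Q ^ 2) := by gcongr
      have h9 : ((j : ℝ) - i) / Q ^ 2 = ((j : ℝ) - i) / (2 * Q ^ 2) + ((j : ℝ) - i) / (2 * Q ^ 2) := by
        field_simp; norm_num
      linarith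
  have hlarge : 1024 ≤ ((A.N * M : ℕ) : ℝ) ^ u * ρ' := by
    have h1 : A.ρ / 256 * (Q : ℝ) ^ 2 ≤ (A.N * M : ℕ) := by
      refine hM.trans ?_
      exact_mod_cast Nat.le_mul_of_pos_left M A.N_pos
    refine hQ5.trans ?_
    calc (A.ρ / 256) ^ u * (Q : ℝ) ^ (2 * u - (1 + w))
        = (A.ρ / 256 * (Q : ℝ) ^ 2) ^ u * ρ' := by
          rw [Real.mul_rpow (by positivity) (by positivity), ← Real.rpow_natCast,
            ← Real.rpow_mul hQ.le, mul_assoc, hρ', ← Real.rpow_add hQ]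
          norm_num
          left; ring_nf
      _ ≤ _ := by
          gcongr
  refine ⟨⟨A.N * M, ρ', f', Nat.mul_pos A.N_pos hM0, hρ'_pos, hsep, hlarge⟩, M, hM2, rfl,
    fun j _ => ⟨hlow j, hup j, _, rfl, ?_, ?_⟩⟩
  · have := (hS _ _ (hg (A.f (j / M)) _ (hmod j))).2.2.1
    omega
  · have := (hS _ _ (hg (A.f (j / M)) _ (hmod j))).2.2.2
    exact Real.rpow_le_rpow_of_nonpos (by exact_mod_cast Rat.pos _) (by exact_mod_cast this)
      (by linarith)

/-- A map which expands distances at least like `t ↦ t ^ u` has a range of dimension at least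
`1 / u`. -/
theorem le_dimH_image_of_rpow_le {h : ℝ → ℝ} {u : ℝ} (hu : 0 < u)
    (sep : ∀ t t', 0 ≤ t → t < t' → t' < 1 → (t' - t) ^ u ≤ h t' - h t) :
    ENNReal.ofReal (1 / u) ≤ dimH (h '' Set.Ico 0 1) := by
  have hinj : Set.InjOn h (Set.Ico 0 1) := by
    have : StrictMonoOn h (Set.Ico 0 1) := fun t ht t' ht' htt => by
      have h1 := sep t t' ht.1 htt ht'.2
      have h2 := Real.rpow_pos_of_pos (sub_pos.2 htt) u
      linarith
    exact this.injOn
  let g := Function.invFunOn h (Set.Ico (0 : ℝ) 1)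
  have hg : ∀ t ∈ Set.Ico (0 : ℝ) 1, g (h t) = t := fun t ht => hinj.leftInvOn_invFunOn ht
  have hdist : ∀ t ∈ Set.Ico (0 : ℝ) 1, ∀ t' ∈ Set.Ico (0 : ℝ) 1,
      dist t t' ≤ dist (h t) (h t') ^ (1 / u) := by
    have key : ∀ t ∈ Set.Ico (0 : ℝ) 1, ∀ t' ∈ Set.Ico (0 : ℝ) 1, t < t' →
        dist t t' ≤ dist (h t) (h t') ^ (1 / u) := by
      intro t ht t' ht' htt
      have h0 := sub_pos.2 htt
      have h1 := (sep t t' ht.1 htt ht'.2).trans (le_abs_self _)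
      rw [dist_comm, dist_comm (h t), Real.dist_eq, Real.dist_eq, abs_of_pos h0]
      calc t' - t = ((t' - t) ^ u) ^ (1 / u) := by
            rw [← Real.rpow_mul h0.le, mul_one_div_cancel hu.ne', Real.rpow_one]
        _ ≤ _ := Real.rpow_le_rpow (by positivity) h1 (by positivity)
    intro t ht t' ht'
    rcases lt_trichotomy t t' with hlt | rfl | hlt
    · exact key t ht t' ht' hlt
    · simp only [dist_self]; positivity
    · rw [dist_comm, dist_comm (h t)]; exact key t' ht' t ht hlt
  have hr : 0 < (1 / u).toNNReal := Real.toNNReal_pos.2 (by positivity)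
  -- The inverse is Hölder of exponent `1 / u` and its image `[0, 1)` has dimension 1.
  have hold : HolderOnWith 1 (1 / u).toNNReal g (h '' Set.Ico 0 1) := by
    rintro _ ⟨t, ht, rfl⟩ _ ⟨t', ht', rfl⟩
    rw [hg t ht, hg t' ht', ENNReal.coe_one, one_mul, edist_dist, edist_dist,
      Real.coe_toNNReal _ (by positivity), ENNReal.ofReal_rpow_of_nonneg dist_nonneg (by positivity)]
    exact ENNReal.ofReal_le_ofReal (hdist t ht t' ht')
  have himg : g '' (h '' Set.Ico 0 1) = Set.Ico 0 1 := by
    rw [Set.image_image, Set.image_congr hg, Set.image_id']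
  have hdim := hold.dimH_image_le hr
  rw [himg, Real.dimH_of_nonempty_interior (by simp), Module.finrank_self, Nat.cast_one,
    ENNReal.le_div_iff_mul_le (by simp [hu]) (by simp), one_mul] at hdim
  exact hdim

theorem mem_approxLine_of_forall_exists_rat {x w : ℝ}
    (h : ∀ T : ℕ, ∃ v : ℚ, T ≤ v.den ∧ |x - v| ≤ (v.den : ℝ) ^ (-(1 + w))) :
    x ∈ approxLine w := by
  intro ε hε
  refine Set.infinite_of_forall_exists_gt fun T => ?_
  obtain ⟨v, hT, hv⟩ := h (T + 1)
  refine ⟨v.den, ⟨v.pos, (distInt_le_abs_sub _ v.num).trans ?_⟩, by omega⟩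
  have hd : (0 : ℝ) < v.den := by exact_mod_cast v.pos
  have hd1 : (1 : ℝ) ≤ v.den := by exact_mod_cast v.pos
  have hv1 : (v.num : ℝ) = v.den * v := by
    rw [mul_comm]; exact_mod_cast v.mul_den_eq_num.symm
  rw [hv1, ← mul_sub, abs_mul, abs_of_pos hd]
  calc (v.den : ℝ) * |x - v| ≤ v.den * (v.den : ℝ) ^ (-(1 + w)) := by gcongr
    _ = (v.den : ℝ) ^ (-w) := by
        rw [show -w = 1 + -(1 + w) by ring, Real.rpow_add hd, Real.rpow_one]
    _ ≤ _ := Real.rpow_le_rpow_of_exponent_le hd1 (by linarith)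

/-- Iterated refinement assigns to each `t` in `[0, 1)` a nested sequence of intervals, the one at
stage `n` having index `⌊t * N⌋`. The common point `h t` is approximable to order `w`, and `sep`
passes to the limit as the expansion property of `h`. -/
theorem le_dimH_approxLine_of_lt {u w : ℝ} (hw : 1 < w) (hu : 1 + w < 2 * u) :
    ENNReal.ofReal (1 / u) ≤ dimH (approxLine w) := by
  have hu0 : 0 < u := by linarith
  -- With a single interval `sep` is vacuous, and length 1024 gives `large`.
  let A₀ : CantorStage u := ⟨1, 1024, fun _ => 0, one_pos, by norm_num, by omega, by simp⟩
  choose next hnext using fun T A => CantorStage.exists_isRefinement hw hu T A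
  let L : ℕ → CantorStage u := fun n => Nat.rec A₀ (fun n A => next n A) n
  have hL : ∀ n, (L n).IsRefinement w n (L (n + 1)) := fun n => hnext n (L n)
  let idx : ℕ → ℝ → ℕ := fun n t => ⌊t * (L n).N⌋₊
  have hidx : ∀ n t, 0 ≤ t → t < 1 → idx n t < (L n).N := by
    intro n t h0 h1
    have hN : (0 : ℝ) < (L n).N := by exact_mod_cast (L n).N_pos
    exact (Nat.floor_lt (by positivity)).2 (by nlinarith)
  let a : ℝ → ℕ → ℝ := fun t n => (L n).f (idx n t)
  let b : ℝ → ℕ → ℝ := fun t n => (L n).f (idx n t) + (L n).ρ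
  have hstep : ∀ t n, 0 ≤ t → t < 1 → a t n ≤ a t (n + 1) ∧ b t (n + 1) ≤ b t n ∧
      ∃ v : ℚ, a t (n + 1) = v ∧ n ≤ v.den ∧ (L (n + 1)).ρ ≤ (v.den : ℝ) ^ (-(1 + w)) := by
    intro t n h0 h1
    obtain ⟨M, hM, hN, hj⟩ := hL n
    -- Cells of the finer stage subdivide those of the coarser: `⌊t * N * M⌋ / M = ⌊t * N⌋`.
    have hdiv : idx (n + 1) t / M = idx n t := by
      simp only [idx, hN]
      rw [← Nat.floor_div_natCast, Nat.cast_mul, ← mul_assoc,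
        mul_div_cancel_right₀ _ (by positivity)]
    have := hj _ (hidx (n + 1) t h0 h1)
    rwa [hdiv] at this
  have hNn : ∀ n, n ≤ (L n).N := by
    intro n
    induction n with
    | zero => exact Nat.zero_le _
    | succ n ih =>
      obtain ⟨M, hM, hN, -⟩ := hL n
      have := (L n).N_pos
      rw [hN]; nlinarith
  let h : ℝ → ℝ := fun t => ⨆ n, a t n
  have hmem : ∀ t n, 0 ≤ t → t < 1 → a t n ≤ h t ∧ h t ≤ b t n := by
    intro t n h0 h1
    have := Monotone.ciSup_mem_iInter_Icc_of_antitone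
      (monotone_nat_of_le_succ fun n => (hstep t n h0 h1).1)
      (antitone_nat_of_succ_le fun n => (hstep t n h0 h1).2.1)
      (fun n => by simp only [a, b]; linarith [(L n).ρ_pos])
    exact Set.mem_iInter.1 this n
  have hsub : h '' Set.Ico 0 1 ⊆ approxLine w := by
    rintro _ ⟨t, ⟨h0, h1⟩, rfl⟩
    refine mem_approxLine_of_forall_exists_rat fun T => ?_
    obtain ⟨-, -, v, hv, hT, hρ⟩ := hstep t T h0 h1
    refine ⟨v, hT, ?_⟩
    have h2 := hmem t (T + 1) h0 h1
    rw [← hv, abs_of_nonneg (sub_nonneg.2 h2.1)]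
    have h3 : b t (T + 1) = a t (T + 1) + (L (T + 1)).ρ := rfl
    linarith [h2.2]
  refine (le_dimH_image_of_rpow_le hu0 ?_).trans (dimH_mono hsub)
  intro t t' h0 htt h1
  -- A stage with more than `1 / (t' - t)` cells puts `t` and `t'` into different ones.
  obtain ⟨n, hn⟩ := exists_nat_gt (1 / (t' - t))
  have hd := sub_pos.2 htt
  have ht' : 0 ≤ t' := h0.trans htt.le
  have hn' : 1 / (t' - t) < (L n).N := hn.trans_le (by exact_mod_cast hNn n)
  have hN : (0 : ℝ) < (L n).N := by exact_mod_cast (L n).N_pos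
  rw [div_lt_iff₀ hd] at hn'
  have f1 : (idx n t : ℝ) ≤ t * (L n).N := Nat.floor_le (by positivity)
  have f2 : t' * (L n).N < idx n t' + 1 := Nat.lt_floor_add_one _
  have hlt : idx n t < idx n t' := by
    have : (idx n t : ℝ) < idx n t' := by nlinarith
    exact_mod_cast this
  have hs := (L n).sep _ _ hlt (hidx n t' ht' h1)
  have hp : (t' - t) ^ u ≤ (((idx n t' : ℝ) - idx n t + 1) / (L n).N) ^ u := by
    refine Real.rpow_le_rpow hd.le ?_ hu0.le
    rw [le_div_iff₀ hN]
    nlinarith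
  have g1 := (hmem t n h0 (htt.trans h1)).2
  have g2 := (hmem t' n ht' h1).1
  simp only [a, b] at g1 g2
  linarith

open Filter Topology in
/-- The lower bound in the theorem of Jarník and Besicovitch. -/
theorem le_dimH_approxLine {w : ℝ} (hw : 1 < w) :
    ENNReal.ofReal (2 / (1 + w)) ≤ dimH (approxLine w) := by
  have h1 : Tendsto (fun n : ℕ => (1 + w) / 2 + 1 / ((n : ℝ) + 1)) atTop (𝓝 ((1 + w) / 2 + 0)) :=
    tendsto_one_div_add_atTop_nhds_zero_nat.const_add _
  rw [add_zero] at h1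
  have h2 := ENNReal.tendsto_ofReal ((tendsto_const_nhds (x := (1 : ℝ))).div h1 (by linarith))
  rw [one_div_div] at h2
  refine le_of_tendsto' h2 fun n => le_dimH_approxLine_of_lt hw ?_
  have : (0 : ℝ) < 1 / ((n : ℝ) + 1) := by positivity
  linarith

/-! ### Jarník–Besicovitch, upper bound: covering by balls around fractions -/

-- The set is covered by the balls of radius `q ^ (-v)` around the `O(q)` relevant fractions `p /
-- q`, for `q` beyond any bound. The total cost `∑ q ^ (1 - v * c)` converges because `v * c > 2`,
-- so its tails tend to zero.
open Filter Topology MeasureTheory Measure in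
theorem hausdorffMeasure_approxLine_inter_Icc {w ε c : ℝ} (hε : 0 < ε) (hc : 0 < c)
    (hv : 2 < (1 + w - ε) * c) (R : ℕ) : μH[c] (approxLine w ∩ Set.Icc (-R) R) = 0 := by
  set v := 1 + w - ε with hvdef
  have hv0 : 0 < v := pos_of_mul_pos_left (by linarith) hc.le
  let B : ℕ → ℤ := fun q => ((R + 1) * q : ℕ)
  -- The denominator is `m + n`, so the `n`-th cover uses only denominators at least `n`.
  let ι : ℕ → Type := fun n => Σ m : ℕ, Finset.Icc (-(B (m + n))) (B (m + n))
  let t : ∀ n, ι n → Set ℝ := fun n i =>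
    Metric.closedBall ((i.2 : ℤ) / (i.1 + n : ℕ)) (((i.1 + n : ℕ) : ℝ) ^ (-v))
  let F : ℕ → ℝ := fun q => ((2 * R + 3) * 2 ^ c) * (q : ℝ) ^ (1 - v * c)
  have hdiam : ∀ n i, Metric.ediam (t n i) ≤ ENNReal.ofReal (2 * ((i.1 + n : ℕ) : ℝ) ^ (-v)) := by
    intro n i
    refine Metric.ediam_le_of_forall_dist_le fun x hx y hy => ?_
    have := dist_triangle_right x y ((i.2 : ℤ) / (i.1 + n : ℕ) : ℝ)
    have h1 := Metric.mem_closedBall.1 hx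
    have h2 := Metric.mem_closedBall.1 hy
    linarith
  have hr : Tendsto (fun n : ℕ => ENNReal.ofReal (2 * (n : ℝ) ^ (-v))) atTop (𝓝 0) := by
    have := ((tendsto_rpow_neg_atTop hv0).comp (tendsto_natCast_atTop_atTop (R := ℝ))).const_mul 2
    simpa using ENNReal.tendsto_ofReal this
  have ht : ∀ᶠ n : ℕ in atTop, ∀ i, Metric.ediam (t n i) ≤ ENNReal.ofReal (2 * (n : ℝ) ^ (-v)) := by
    filter_upwards [eventually_gt_atTop 0] with n hn i
    refine (hdiam n i).trans (ENNReal.ofReal_le_ofReal ?_)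
    refine mul_le_mul_of_nonneg_left ?_ (by norm_num)
    exact Real.rpow_le_rpow_of_nonpos (by exact_mod_cast hn) (by push_cast; linarith [Nat.cast_nonneg (α := ℝ) i.1])
      (by linarith)
  have hst : ∀ᶠ n : ℕ in atTop, approxLine w ∩ Set.Icc (-R) R ⊆ ⋃ i, t n i := by
    filter_upwards with n x hx
    obtain ⟨hx, hxR⟩ := hx
    obtain ⟨q, ⟨hq, hqx⟩, hnq⟩ := (hx ε hε).exists_gt n
    have hq' : (0 : ℝ) < q := by exact_mod_cast hq
    have hq1 : (1 : ℝ) ≤ q := by exact_mod_cast hq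
    have hround := abs_sub_round ((q : ℝ) * x)
    have hmem : round ((q : ℝ) * x) ∈ Finset.Icc (-(B q)) (B q) := by
      have h1 := mul_le_mul_of_nonneg_left hxR.1 hq'.le
      have h2 := mul_le_mul_of_nonneg_left hxR.2 hq'.le
      rw [abs_le] at hround
      rw [Finset.mem_Icc, ← Int.cast_le (R := ℝ), ← Int.cast_le (R := ℝ)]
      simp only [B]
      push_cast
      constructor <;> linarith
    have hi : q - n + n = q := by omega
    refine Set.mem_iUnion.2 ⟨⟨q - n, ⟨round ((q : ℝ) * x), by rwa [hi]⟩⟩, ?_⟩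
    simp only [t, hi]
    rw [Metric.mem_closedBall, Real.dist_eq]
    have h3 : x - (round ((q : ℝ) * x) : ℤ) / (q : ℝ) = (q * x - round ((q : ℝ) * x)) / q := by
      field_simp
    have h4 : (q : ℝ) ^ (-v) = (q : ℝ) ^ (-w + ε) / q := by
      rw [← Real.rpow_sub_one hq'.ne', hvdef]; ring_nf
    rw [h3, abs_div, abs_of_pos hq', h4]
    gcongr
    exact hqx
  -- The shift to `n + 1` excludes the denominator 0.
  have hsum : ∀ n : ℕ, ∑' i, Metric.ediam (t (n + 1) i) ^ c ≤
      ∑' m, ENNReal.ofReal (F (m + (n + 1))) := by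
    intro n
    rw [ENNReal.tsum_sigma']
    refine ENNReal.tsum_le_tsum fun m => ?_
    set q := m + (n + 1) with hq
    have hq1 : (1 : ℝ) ≤ q := by exact_mod_cast (by omega : 1 ≤ q)
    have hq0 : (0 : ℝ) < q := by linarith
    have h1 : ∀ p : Finset.Icc (-(B q)) (B q), Metric.ediam (t (n + 1) ⟨m, p⟩) ^ c ≤
        ENNReal.ofReal ((2 * (q : ℝ) ^ (-v)) ^ c) := by
      intro p
      rw [← ENNReal.ofReal_rpow_of_nonneg (by positivity) hc.le]
      exact ENNReal.rpow_le_rpow (hdiam _ _) hc.le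
    refine (ENNReal.tsum_le_tsum h1).trans ?_
    rw [tsum_fintype, Finset.sum_const, nsmul_eq_mul, Finset.card_univ, Fintype.card_coe,
      Int.card_Icc, ← ENNReal.ofReal_natCast, ← ENNReal.ofReal_mul (by positivity)]
    refine ENNReal.ofReal_le_ofReal ?_
    have h2 : ((B q + 1 - -B q).toNat : ℝ) ≤ (2 * R + 3) * q := by
      have : (B q + 1 - -B q).toNat = 2 * ((R + 1) * q) + 1 := by simp only [B]; omega
      rw [this]; push_cast; linarith
    refine (mul_le_mul_of_nonneg_right h2 (by positivity)).trans (le_of_eq ?_)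
    simp only [F]
    rw [Real.mul_rpow (by norm_num) (by positivity), ← Real.rpow_mul hq0.le,
      show 1 - v * c = 1 + -v * c by ring, Real.rpow_add hq0, Real.rpow_one]
    ring
  have hFsum : ∑' q, ENNReal.ofReal (F q) ≠ ⊤ :=
    ((Real.summable_nat_rpow.2 (by linarith)).mul_left _).tsum_ofReal_ne_top
  have htail : Tendsto (fun n : ℕ => ∑' m, ENNReal.ofReal (F (m + (n + 1)))) atTop (𝓝 0) :=
    (ENNReal.tendsto_sum_nat_add _ hFsum).comp (tendsto_add_atTop_nat 1)
  have hle := hausdorffMeasure_le_liminf_tsum c (approxLine w ∩ Set.Icc (-R) R)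
    _ (hr.comp (tendsto_add_atTop_nat 1)) (fun n => t (n + 1))
    ((tendsto_add_atTop_nat 1).eventually ht) ((tendsto_add_atTop_nat 1).eventually hst)
  refine le_antisymm (hle.trans ?_) bot_le
  refine (liminf_le_liminf (Eventually.of_forall hsum)).trans (le_of_eq ?_)
  exact htail.liminf_eq

open MeasureTheory Measure in
theorem dimH_approxLine_le_of_lt {w c : ℝ} (hc : 0 < c) (hcw : 2 < (1 + w) * c) :
    dimH (approxLine w) ≤ ENNReal.ofReal c := by
  have hw : 2 / c < 1 + w := by rwa [div_lt_iff₀ hc]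
  have hunion : approxLine w ⊆ ⋃ R : ℕ, approxLine w ∩ Set.Icc (-(R : ℝ)) R := by
    intro x hx
    obtain ⟨R, hR⟩ := exists_nat_ge |x|
    exact Set.mem_iUnion.2 ⟨R, hx, abs_le.1 hR⟩
  refine (dimH_mono hunion).trans ?_
  rw [dimH_iUnion]
  refine iSup_le fun R => ?_
  refine dimH_le_of_hausdorffMeasure_ne_top (d := c.toNNReal) ?_
  rw [Real.coe_toNNReal c hc.le, hausdorffMeasure_approxLine_inter_Icc
    (ε := (1 + w - 2 / c) / 2) (by linarith) hc ?_ R]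
  · exact ENNReal.zero_ne_top
  · have : 2 / c * c = 2 := div_mul_cancel₀ _ hc.ne'
    nlinarith

open Filter Topology in
/-- The upper bound in the theorem of Jarník and Besicovitch. -/
theorem dimH_approxLine_le {w : ℝ} (hw : 0 < 1 + w) :
    dimH (approxLine w) ≤ ENNReal.ofReal (2 / (1 + w)) := by
  have h1 : Tendsto (fun n : ℕ => 2 / (1 + w) + 1 / ((n : ℝ) + 1)) atTop (𝓝 (2 / (1 + w) + 0)) :=
    tendsto_one_div_add_atTop_nhds_zero_nat.const_add _
  rw [add_zero] at h1
  refine ge_of_tendsto' (ENNReal.tendsto_ofReal h1) fun n =>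
    dimH_approxLine_le_of_lt (by positivity) ?_
  have h2 : (0 : ℝ) < 1 / ((n : ℝ) + 1) := by positivity
  have h3 : (1 + w) * (2 / (1 + w)) = 2 := mul_div_cancel₀ _ hw.ne'
  nlinarith [mul_pos hw h2]

/-! ### Values of rational polynomials at fractions -/

theorem exists_int_poly_eq_natCast_mul_aeval (p : ℚ[X]) : ∃ D : ℕ, 0 < D ∧ ∃ R : ℤ[X],
    R.natDegree = p.natDegree ∧ ∀ x : ℝ, aeval x R = D * aeval x p := by
  obtain ⟨b, hb, h⟩ := IsLocalization.integerNormalization_spec (nonZeroDivisors ℤ) p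
  have hb0 : b ≠ 0 := nonZeroDivisors.ne_zero hb
  set R := IsLocalization.integerNormalization (nonZeroDivisors ℤ) p
  have hpos : 0 < b * b := mul_self_pos.2 hb0
  have habs : ((b * b).natAbs : ℤ) = b * b := Int.natAbs_of_nonneg hpos.le
  have hmap : R.map (algebraMap ℤ ℚ) = C (b : ℚ) * p := by
    rw [h, ← smul_eq_C_mul]; simp [← Int.cast_smul_eq_zsmul ℚ]
  -- The multiplier `b` may be negative, whereas `b * b` is positive.
  refine ⟨(b * b).natAbs, Int.natAbs_pos.2 hpos.ne', C b * R, ?_, fun x => ?_⟩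
  · rw [natDegree_C_mul hb0,
      ← natDegree_map_eq_of_injective (algebraMap ℤ ℚ).injective_int R, hmap,
      natDegree_C_mul (by exact_mod_cast hb0)]
  · have h1 : aeval x R = b * aeval x p := by
      rw [← aeval_map_algebraMap ℚ, hmap]; simp
    rw [map_mul, h1, aeval_C, ← Int.cast_natCast, habs]
    push_cast
    simp [mul_assoc]

/-- Clearing denominators in the value of an integer polynomial at a rational number. -/
theorem exists_int_eq_den_pow_mul_aeval (R : ℤ[X]) (v : ℚ) : ∃ z y : ℤ,
    (z : ℝ) = (v.den : ℝ) ^ R.natDegree * aeval (v : ℝ) R ∧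
      z = R.leadingCoeff * v.num ^ R.natDegree + v.den * y := by
  -- Every term of the homogenised polynomial except the leading one carries a factor `v.den`.
  have hdvd : (v.den : ℤ) ∣ (R.scaleRoots v.den).eval v.num -
      R.leadingCoeff * v.num ^ R.natDegree := by
    rw [eval_eq_sum_range, natDegree_scaleRoots, Finset.sum_range_succ]
    simp only [coeff_scaleRoots, Nat.sub_self, pow_zero, mul_one, coeff_natDegree,
      add_sub_cancel_right]
    refine Finset.dvd_sum fun i hi => ?_
    have : (v.den : ℤ) ∣ (v.den : ℤ) ^ (R.natDegree - i) :=
      dvd_pow_self _ (by have := Finset.mem_range.1 hi; omega)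
    exact (this.mul_left _).mul_right _
  obtain ⟨y, hy⟩ := hdvd
  refine ⟨(R.scaleRoots v.den).eval v.num, y, ?_, by linarith⟩
  have h := scaleRoots_eval₂_mul (p := R) (Int.castRingHom ℝ) (v : ℝ) (v.den : ℤ)
  have hv : (v.den : ℝ) * v = v.num := by
    rw [mul_comm]; exact_mod_cast v.mul_den_eq_num
  simp only [eq_intCast, Int.cast_natCast, hv] at h
  rw [aeval_def, algebraMap_int_eq, ← h, ← eq_intCast (Int.castRingHom ℝ) v.num, eval₂_at_apply]
  simp

theorem exists_abs_aeval_sub_le (p : ℚ[X]) (x : ℝ) : ∃ K : ℝ, 0 < K ∧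
    ∀ y : ℝ, |x - y| ≤ 1 → |aeval y p - aeval x p| ≤ K * |x - y| := by
  obtain ⟨G, hG⟩ := X_sub_C_dvd_sub_C_eval (a := x) (p := p.map (algebraMap ℚ ℝ))
  obtain ⟨K, hK⟩ := (isCompact_Icc (a := x - 1) (b := x + 1)).exists_bound_of_continuousOn
    G.continuous.continuousOn
  refine ⟨|K| + 1, by positivity, fun y hy => ?_⟩
  have h := congrArg (eval y) hG
  simp only [eval_sub, eval_map_algebraMap, eval_C, eval_mul, eval_X] at h
  have hy' := abs_le.1 hy
  have h1 := hK y ⟨by linarith, by linarith⟩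
  rw [h, abs_mul, abs_sub_comm, mul_comm]
  gcongr
  exact h1.trans ((le_abs_self K).trans (by linarith))

/-- If `l = 1`, then `z` is a unit modulo `b ^ n`. In general, inverting `a ^ n` modulo `b` makes
`l` a multiple of `z` plus a multiple of `b`; taking `n`-th powers, `l ^ n` is a multiple of `z`
modulo `b ^ n`. -/
theorem pow_dvd_pow_mul_of_dvd_mul {a b l m y z : ℤ} {n : ℕ} (hab : IsCoprime a b)
    (hz : z = l * a ^ n + b * y) (h : b ^ n ∣ m * z) : b ^ n ∣ l ^ n * m := by
  obtain ⟨u, v, huv⟩ := hab.pow_left (m := n)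
  have hl : l = u * z + b * (l * v - u * y) := by
    rw [hz]; linear_combination (-l) * huv
  obtain ⟨s, hs⟩ := sub_dvd_pow_sub_pow (u * z + b * (l * v - u * y)) (b * (l * v - u * y)) n
  rw [← hl, mul_pow] at hs
  obtain ⟨c, hc⟩ := h
  have : l - b * (l * v - u * y) = u * z := by linear_combination hl
  rw [this] at hs
  exact ⟨c * u * s + (l * v - u * y) ^ n * m, by linear_combination m * hs + u * s * hc⟩

theorem den_intCast_div_natCast_dvd (p : ℤ) (q : ℕ) : ((p : ℚ) / q).den ∣ q := by
  have := Rat.den_dvd p q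
  exact_mod_cast this

theorem abs_sub_round_div_le {q : ℕ} (hq : 0 < q) {x s : ℝ}
    (h : distInt (q * x) ≤ (q : ℝ) ^ s) :
    |x - (((round (q * x) : ℤ) : ℚ) / (q : ℚ) : ℚ)| ≤ (q : ℝ) ^ (s - 1) := by
  have hq' : (0 : ℝ) < q := by exact_mod_cast hq
  push_cast
  have h3 : x - (round ((q : ℝ) * x) : ℤ) / (q : ℝ) = (q * x - round ((q : ℝ) * x)) / q := by
    field_simp
  rw [h3, abs_div, abs_of_pos hq', Real.rpow_sub_one hq'.ne']
  gcongr
  exact h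

open Filter Topology in
theorem eventually_le_natCast_rpow (c : ℝ) {s : ℝ} (hs : 0 < s) :
    ∀ᶠ q : ℕ in atTop, c ≤ (q : ℝ) ^ s :=
  ((tendsto_rpow_atTop hs).comp (tendsto_natCast_atTop_atTop (R := ℝ))).eventually_ge_atTop c

/-! ### The first inclusion -/

-- If `q` is good for `x`, then `E * q ^ n` is good for all the `P j` at once, `E` being a common
-- denominator: at `v = round (q x) / q` the multiplied values are integers, and passing from `v` to
-- `x` costs a Lipschitz constant.
open Filter in
theorem infinite_simultaneous_of_mem_approxLine {k n : ℕ} (P : Fin k → ℚ[X]) (hn : 1 ≤ n)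
    (hP : ∀ j, (P j).natDegree ≤ n) {lam : ℝ} (hlam : 0 < lam) {x : ℝ}
    (hx : x ∈ approxLine (n * lam + n - 1)) {ε : ℝ} (hε : 0 < ε) :
    {q : ℕ | 0 < q ∧ ∀ j, distInt (q * aeval x (P j)) ≤ (q : ℝ) ^ (-lam + ε)}.Infinite := by
  have hn0 : (1 : ℝ) ≤ n := by exact_mod_cast hn
  choose D hD R hR hRx using fun j => exists_int_poly_eq_natCast_mul_aeval (P j)
  choose K hK hKx using fun j => exists_abs_aeval_sub_le (P j) x
  set E := ∏ j, D j with hE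
  have hE0 : 0 < E := Finset.prod_pos fun j _ => hD j
  have hEr : (0 : ℝ) < E := by exact_mod_cast hE0
  -- The bound `n * lam` ensures `|x - v| ≤ 1`; the bound `ε / 2` leaves a positive power `q ^ (n *
  -- ε - δ)` to absorb the constants.
  set δ := min (ε / 2) (n * lam) with hδ
  have hδ0 : 0 < δ := lt_min (by linarith) (by positivity)
  have hδ1 : δ ≤ ε / 2 := min_le_left _ _
  have hδ2 : δ ≤ n * lam := min_le_right _ _
  have hnε : ε ≤ n * ε := le_mul_of_one_le_left hε.le hn0
  have hlarge : ∀ᶠ q : ℕ in atTop, ∀ j, E * K j / (E : ℝ) ^ (-lam + ε) ≤ (q : ℝ) ^ (n * ε - δ) :=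
    eventually_all.2 fun j => eventually_le_natCast_rpow _ (by linarith)
  have hfreq := (Nat.frequently_atTop_iff_infinite.2 (hx δ hδ0)).and_eventually hlarge
  rw [← Nat.frequently_atTop_iff_infinite]
  have htends : Tendsto (fun q : ℕ => E * q ^ n) atTop atTop :=
    (tendsto_pow_atTop (by omega)).const_mul_atTop' hE0
  refine htends.frequently (hfreq.mono ?_)
  rintro q ⟨⟨hq, hqx⟩, hqE⟩
  refine ⟨by positivity, fun j => ?_⟩
  have hq0 : (0 : ℝ) < q := by exact_mod_cast hq
  have hq1 : (1 : ℝ) ≤ q := by exact_mod_cast hq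
  set v : ℚ := ((round (q * x) : ℤ) : ℚ) / q with hv
  have hxv := abs_sub_round_div_le hq hqx
  rw [← hv] at hxv
  have hxv1 : |x - v| ≤ 1 :=
    hxv.trans (Real.rpow_le_one_of_one_le_of_nonpos hq1 (by linarith))
  obtain ⟨z, -, hz, -⟩ := exists_int_eq_den_pow_mul_aeval (R j) v
  obtain ⟨c, hc⟩ : v.den ^ (R j).natDegree ∣ q ^ n :=
    (pow_dvd_pow_of_dvd (den_intCast_div_natCast_dvd _ q) _).trans
      (pow_dvd_pow q ((hR j).trans_le (hP j)))
  obtain ⟨e, he⟩ : D j ∣ E := Finset.dvd_prod_of_mem D (Finset.mem_univ j)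
  have hint : ((E * q ^ n : ℕ) : ℝ) * aeval (v : ℝ) (P j) = ((e * c * z : ℤ) : ℝ) := by
    have hc' : (q : ℝ) ^ n = (v.den : ℝ) ^ (R j).natDegree * c := by exact_mod_cast hc
    push_cast
    rw [hz, hRx, he, hc']
    push_cast
    ring
  refine (distInt_le_abs_sub _ (e * c * z)).trans ?_
  rw [← hint, ← mul_sub, abs_mul, Nat.abs_cast, abs_sub_comm]
  have h1 := hKx j v hxv1
  have h2 := hqE j
  rw [div_le_iff₀ (by positivity)] at h2
  have h3 : ((E * q ^ n : ℕ) : ℝ) ^ (-lam + ε) = (E : ℝ) ^ (-lam + ε) * (q : ℝ) ^ (n * (-lam + ε)) := by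
    push_cast
    rw [Real.mul_rpow hEr.le (by positivity), ← Real.rpow_natCast, ← Real.rpow_mul hq0.le]
  rw [h3]
  calc ((E * q ^ n : ℕ) : ℝ) * |aeval (v : ℝ) (P j) - aeval x (P j)|
      ≤ ((E * q ^ n : ℕ) : ℝ) * (K j * (q : ℝ) ^ (-(n * lam + n - 1) + δ - 1)) := by
        refine mul_le_mul_of_nonneg_left (h1.trans ?_) (by positivity)
        exact mul_le_mul_of_nonneg_left hxv (hK j).le
    _ = E * K j * (q : ℝ) ^ (-(n * lam) + δ) := by
        have h4 : (q : ℝ) ^ (-(n * lam) + δ) =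
            (q : ℝ) ^ n * (q : ℝ) ^ (-(n * lam + n - 1) + δ - 1) := by
          rw [← Real.rpow_natCast, ← Real.rpow_add hq0]
          congr 1; ring
        rw [h4]
        push_cast
        ring
    _ ≤ (q : ℝ) ^ (n * ε - δ) * (E : ℝ) ^ (-lam + ε) * (q : ℝ) ^ (-(n * lam) + δ) := by gcongr
    _ = _ := by
        have h4 : (q : ℝ) ^ (n * (-lam + ε)) =
            (q : ℝ) ^ (n * ε - δ) * (q : ℝ) ^ (-(n * lam) + δ) := by
          rw [← Real.rpow_add hq0]
          congr 1; ring
        rw [h4]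
        ring

/-! ### The second inclusion -/

open Filter in
/-- If `q` approximates all the `P i x` well and the degree jumps up to `j` do not exceed `τ`, then
`q` is, up to a bounded factor, divisible by the `deg P j`-th power of the denominator of the
approximation to `x`. -/
theorem exists_den_pow_dvd {k : ℕ} (hk : 1 ≤ k) (P : Fin k → ℚ[X]) (hP : P ⟨0, hk⟩ = X)
    (d : Fin k → ℕ) (hd : ∀ j, d j = (P j).natDegree) (hmono : Monotone d)
    {τ lam ε x : ℝ} (hτ : 0 < τ) (hε : ε < lam - τ) (r : Fin k)
    (hr : ∀ j, ∀ h : j + 1 < k, j < (r : ℕ) →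
      (d ⟨j + 1, h⟩ : ℝ) - d ⟨j, by omega⟩ ≤ τ) (j : ℕ) (hj : j ≤ r) :
    ∃ C : ℕ, 0 < C ∧ ∀ᶠ q : ℕ in atTop,
      (∀ i, distInt (q * aeval x (P i)) ≤ (q : ℝ) ^ (-lam + ε)) →
      ((((round (q * x) : ℤ) : ℚ) / q).den : ℤ) ^ d ⟨j, by omega⟩ ∣ C * q := by
  induction j with
  | zero =>
    refine ⟨1, one_pos, Eventually.of_forall fun q _ => ?_⟩
    have h : d ⟨0, by omega⟩ = 1 := by rw [hd, hP, natDegree_X]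
    rw [h, pow_one, Nat.cast_one, one_mul]
    exact_mod_cast den_intCast_div_natCast_dvd _ q
  | succ j ih =>
    obtain ⟨C, hC, hCq⟩ := ih (by omega)
    have hjk : j + 1 < k := by omega
    have hle : d ⟨j, by omega⟩ ≤ d ⟨j + 1, hjk⟩ := hmono (Fin.mk_le_mk.2 (Nat.le_succ j))
    obtain ⟨t, ht⟩ := Nat.exists_eq_add_of_le hle
    have htτ : (t : ℝ) ≤ τ := by
      have := hr j hjk (by omega)
      rw [ht] at this
      push_cast at this
      linarith
    set p := P ⟨j + 1, hjk⟩ with hp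
    set n := d ⟨j + 1, hjk⟩ with hn
    set n₀ := d ⟨j, by omega⟩
    have hn1 : 1 ≤ n := by
      have h1 : d ⟨0, hk⟩ ≤ n := hmono (Fin.mk_le_mk.2 (Nat.zero_le _))
      rwa [hd, hP, natDegree_X] at h1
    obtain ⟨D, hD, R, hR, hRx⟩ := exists_int_poly_eq_natCast_mul_aeval p
    rw [hp, ← hd, ← hn] at hR
    obtain ⟨K, hK, hKx⟩ := exists_abs_aeval_sub_le p x
    set l := R.leadingCoeff
    have hl : l ≠ 0 := by
      rw [leadingCoeff_ne_zero]
      rintro rfl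
      simp at hR
      omega
    refine ⟨(l ^ n).natAbs * C, Nat.mul_pos (Int.natAbs_pos.2 (pow_ne_zero _ hl)) hC, ?_⟩
    have hlarge := eventually_le_natCast_rpow (C * D * (K + 1) + 1)
      (show 0 < lam - τ - ε by linarith)
    filter_upwards [hCq, hlarge, eventually_gt_atTop 0] with q hCq hlarge hq hgood
    obtain ⟨m, hm⟩ := hCq hgood
    have hq0 : (0 : ℝ) < q := by exact_mod_cast hq
    have hq1 : (1 : ℝ) ≤ q := by exact_mod_cast hq
    have hgx := hgood ⟨0, hk⟩
    rw [hP, aeval_X] at hgx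
    have hxv := abs_sub_round_div_le hq hgx
    have hbq := Nat.le_of_dvd hq (den_intCast_div_natCast_dvd (round (q * x)) q)
    set v : ℚ := ((round (q * x) : ℤ) : ℚ) / q
    have hxv1 : |x - v| ≤ 1 :=
      hxv.trans (Real.rpow_le_one_of_one_le_of_nonpos hq1 (by linarith))
    obtain ⟨z, y, hz, hzy⟩ := exists_int_eq_den_pow_mul_aeval R v
    rw [hR] at hz hzy
    set N := round ((q : ℝ) * aeval x p)
    have h1 : |q * aeval (v : ℝ) p - N| ≤ (K + 1) * (q : ℝ) ^ (-lam + ε) := by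
      have e1 : (q : ℝ) * aeval (v : ℝ) p - N =
          q * (aeval (v : ℝ) p - aeval x p) + (q * aeval x p - N) := by ring
      have e2 : (q : ℝ) * |aeval (v : ℝ) p - aeval x p| ≤ K * (q : ℝ) ^ (-lam + ε) := by
        calc (q : ℝ) * |aeval (v : ℝ) p - aeval x p|
            ≤ q * (K * (q : ℝ) ^ (-lam + ε - 1)) :=
              mul_le_mul_of_nonneg_left ((hKx v hxv1).trans (by gcongr)) hq0.le
          _ = _ := by rw [Real.rpow_sub_one hq0.ne']; field_simp
      have e3 : |q * aeval x p - N| ≤ (q : ℝ) ^ (-lam + ε) := hgood ⟨j + 1, hjk⟩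
      rw [e1]
      refine (abs_add_le _ _).trans ?_
      rw [abs_mul, Nat.abs_cast]
      linarith
    have hmr : (C : ℝ) * q = (v.den : ℝ) ^ n₀ * m := by exact_mod_cast hm
    -- Multiplication by `C * D * v.den ^ t` turns `q * p(v)` into the integer `m * z`: the factor
    -- `C * q` supplies `v.den ^ n₀` by induction, and `n₀ + t = n`.
    have hint : ((m * z - C * D * N * v.den ^ t : ℤ) : ℝ) =
        C * D * (v.den : ℝ) ^ t * (q * aeval (v : ℝ) p - N) := by
      push_cast
      rw [hz, hRx, ht, pow_add]
      linear_combination (-(v.den : ℝ) ^ t * D * aeval (v : ℝ) p) * hmr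
    have hbt : (v.den : ℝ) ^ t ≤ (q : ℝ) ^ τ := by
      calc (v.den : ℝ) ^ t ≤ (q : ℝ) ^ t := by
            gcongr
        _ = (q : ℝ) ^ (t : ℝ) := (Real.rpow_natCast _ _).symm
        _ ≤ _ := Real.rpow_le_rpow_of_exponent_le hq1 htτ
    -- The multiplier is at most `C * D * q ^ τ` and the error `O(q ^ (-lam + ε))`, with `lam - ε >
    -- τ`.
    have hlt : |((m * z - C * D * N * v.den ^ t : ℤ) : ℝ)| < 1 := by
      rw [hint, abs_mul, abs_of_nonneg (by positivity : (0 : ℝ) ≤ C * D * (v.den : ℝ) ^ t)]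
      calc C * D * (v.den : ℝ) ^ t * |q * aeval (v : ℝ) p - N|
          ≤ C * D * (q : ℝ) ^ τ * ((K + 1) * (q : ℝ) ^ (-lam + ε)) := by gcongr
        _ = C * D * (K + 1) * ((q : ℝ) ^ (lam - τ - ε))⁻¹ := by
          have e : ((q : ℝ) ^ (lam - τ - ε))⁻¹ = (q : ℝ) ^ τ * (q : ℝ) ^ (-lam + ε) := by
            rw [← Real.rpow_neg hq0.le, ← Real.rpow_add hq0]
            congr 1; ring
          rw [e]; ring
        _ < 1 := by
          rw [← div_eq_mul_inv, div_lt_one (by positivity)]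
          linarith
    have hzero : m * z - C * D * N * v.den ^ t = 0 := by
      rw [← Int.abs_lt_one_iff]
      exact_mod_cast hlt
    have hdvd : (v.den : ℤ) ^ n ∣ (C * q) * z :=
      ⟨C * D * N, by rw [hm, ht, pow_add]; linear_combination (v.den : ℤ) ^ n₀ * hzero⟩
    have hcop : IsCoprime v.num (v.den : ℤ) := Rat.isCoprime_num_den v
    have := pow_dvd_pow_mul_of_dvd_mul hcop hzy hdvd
    rw [Nat.cast_mul, mul_assoc]
    rcases Int.natAbs_eq (l ^ n) with h | h
    · rwa [← h]
    · rw [h] at this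
      rwa [neg_mul, dvd_neg] at this

/-- Multiples of the denominator give distance zero. Rational points need this separate treatment
because the denominators of their approximations may stay bounded. -/
theorem ratCast_mem_approxLine (v : ℚ) (w : ℝ) : (v : ℝ) ∈ approxLine w := by
  intro ε _
  refine Set.infinite_of_forall_exists_gt fun T => ⟨v.den * (T + 1),
    ⟨Nat.mul_pos v.pos T.succ_pos, (distInt_le_abs_sub _ (v.num * (T + 1))).trans ?_⟩, ?_⟩
  · have h : (v : ℝ) * v.den = v.num := by exact_mod_cast v.mul_den_eq_num
    push_cast
    rw [← h, show (v.den : ℝ) * (T + 1) * v - v * v.den * (T + 1) = 0 by ring, abs_zero]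
    positivity
  · have := v.pos
    nlinarith

-- With `b` the reduced denominator of `round (q x) / q`, the bound `b ^ d r ≤ C * q` converts an
-- error `q ^ (-s)` into `C ^ s * b ^ (-(d r * s))`. For irrational `x` these `b` are unbounded,
-- which gives infinitely many of them.
open Filter Topology in
theorem mem_approxLine_of_infinite_simultaneous {k : ℕ} (hk : 1 ≤ k) (P : Fin k → ℚ[X])
    (hP : P ⟨0, hk⟩ = X) (d : Fin k → ℕ) (hd : ∀ j, d j = (P j).natDegree) (hmono : Monotone d)
    {τ lam x : ℝ} (hτ : 0 < τ) (hlam : τ < lam) (r : Fin k)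
    (hr : ∀ j, ∀ h : j + 1 < k, j < (r : ℕ) →
      (d ⟨j + 1, h⟩ : ℝ) - d ⟨j, by omega⟩ ≤ τ)
    (hx : ∀ ε : ℝ, 0 < ε →
      {q : ℕ | 0 < q ∧ ∀ j, distInt (q * aeval x (P j)) ≤ (q : ℝ) ^ (-lam + ε)}.Infinite) :
    x ∈ approxLine (d r * lam + d r - 1) := by
  by_cases hirr : Irrational x
  swap
  · obtain ⟨v, rfl⟩ := not_not.1 hirr
    exact ratCast_mem_approxLine v _
  intro ε' hε'
  have hdr : 1 ≤ d r := by
    have h1 : d ⟨0, hk⟩ ≤ d r := hmono (Fin.mk_le_mk.2 (Nat.zero_le _))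
    rwa [hd, hP, natDegree_X] at h1
  have hdr0 : (0 : ℝ) < d r := by exact_mod_cast hdr
  -- The first bound allows the use of `exists_den_pow_dvd`; the second leaves the power `ε' - d r *
  -- ε > 0` of the denominator to absorb `C ^ s`.
  set ε := min ((lam - τ) / 2) (ε' / (2 * d r)) with hε
  have hε0 : 0 < ε := lt_min (by linarith) (by positivity)
  have hε1 : ε ≤ (lam - τ) / 2 := min_le_left _ _
  have hε2 : d r * ε ≤ ε' / 2 := by
    have : ε ≤ ε' / (2 * d r) := min_le_right _ _
    rw [le_div_iff₀ (by positivity)] at this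
    linarith
  set s := 1 + lam - ε with hs
  have hs0 : 0 < s := by linarith
  obtain ⟨C, hC, hCq⟩ := exists_den_pow_dvd hk P hP d hd hmono (x := x) hτ
    (show ε < lam - τ by linarith) r hr r le_rfl
  have hC0 : (0 : ℝ) < C := by exact_mod_cast hC
  obtain ⟨B₀, hB₀⟩ := eventually_atTop.1
    (eventually_le_natCast_rpow ((C : ℝ) ^ s) (show 0 < ε' - d r * ε by linarith))
  refine Set.infinite_of_forall_exists_gt fun B => ?_
  -- An irrational number has positive distance `η` from the rationals of denominator at most `max B
  -- B₀`, so an approximation closer than `η` has a larger denominator.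
  obtain ⟨η, hη, hη0⟩ := ((hirr.eventually_forall_le_dist_cast_rat_of_den_le (max B B₀)).filter_mono
    nhdsWithin_le_nhds |>.and (self_mem_nhdsWithin (s := Set.Ioi (0 : ℝ)))).exists
  have hclose : ∀ᶠ q : ℕ in atTop, (q : ℝ) ^ (-s) < η :=
    ((tendsto_rpow_neg_atTop hs0).comp (tendsto_natCast_atTop_atTop (R := ℝ))).eventually_lt_const
      hη0
  obtain ⟨q, ⟨hq, hgood⟩, hCq, hclose⟩ :=
    ((Nat.frequently_atTop_iff_infinite.2 (hx ε hε0)).and_eventually (hCq.and hclose)).exists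
  have hq0 : (0 : ℝ) < q := by exact_mod_cast hq
  have hdvd := hCq hgood
  have hgx := hgood ⟨0, hk⟩
  rw [hP, aeval_X] at hgx
  have hxv := abs_sub_round_div_le hq hgx
  rw [show -lam + ε - 1 = -s by rw [hs]; ring] at hxv
  set v : ℚ := ((round (q * x) : ℤ) : ℚ) / q
  have hden : max B B₀ < v.den := by
    by_contra! hcon
    have h1 := hη v hcon
    rw [Real.dist_eq] at h1
    linarith
  have hb0 : (0 : ℝ) < v.den := by exact_mod_cast v.pos
  have hpow : (v.den : ℝ) ^ d r ≤ C * q := by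
    have hdvd' : v.den ^ d r ∣ C * q := by exact_mod_cast hdvd
    exact_mod_cast Nat.le_of_dvd (Nat.mul_pos hC hq) hdvd'
  refine ⟨v.den, ⟨v.pos, (distInt_le_abs_sub _ v.num).trans ?_⟩,
    (le_max_left _ _).trans_lt hden⟩
  have hv1 : (v.num : ℝ) = v.den * v := by
    rw [mul_comm]; exact_mod_cast v.mul_den_eq_num.symm
  have hCle := hB₀ v.den ((le_max_right _ _).trans hden.le)
  have hqs : (q : ℝ) ^ (-s) ≤ (C : ℝ) ^ s * (v.den : ℝ) ^ (-(d r * s)) := by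
    have h1 : (v.den : ℝ) ^ (d r * s) ≤ (C : ℝ) ^ s * (q : ℝ) ^ s := by
      rw [← Real.mul_rpow hC0.le hq0.le, Real.rpow_mul hb0.le, Real.rpow_natCast]
      exact Real.rpow_le_rpow (by positivity) hpow hs0.le
    rw [Real.rpow_neg hq0.le, Real.rpow_neg hb0.le, ← div_eq_mul_inv, ← one_div,
      div_le_div_iff₀ (by positivity) (by positivity)]
    linarith
  rw [hv1, ← mul_sub, abs_mul, abs_of_pos hb0]
  calc (v.den : ℝ) * |x - v|
      ≤ v.den * ((v.den : ℝ) ^ (ε' - d r * ε) * (v.den : ℝ) ^ (-(d r * s))) :=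
        mul_le_mul_of_nonneg_left (hxv.trans (hqs.trans (by gcongr))) hb0.le
    _ = _ := by
        rw [show -((d r : ℝ) * lam + d r - 1) + ε' = 1 + (ε' - d r * ε + -(d r * s)) by
          rw [hs]; ring, Real.rpow_add hb0, Real.rpow_add hb0, Real.rpow_one]

/-! ### Transfer to the curve and conclusion -/

theorem mem_approxSet_one {ζ : EuclideanSpace ℝ (Fin 1)} {w : ℝ} :
    ζ ∈ approxSet 1 w ↔ ζ 0 ∈ approxLine w := by
  simp [approxSet, approxLine]

theorem dimH_image_polyCurve_le {k : ℕ} (P : Fin k → ℚ[X]) (A : Set ℝ) :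
    dimH ((fun x : ℝ => WithLp.toLp 2 fun j : Fin k => aeval x (P j)) '' A) ≤ dimH A := by
  refine ContDiffOn.dimH_image_le (s := Set.univ) (ContDiff.contDiffOn ?_) convex_univ
    (Set.subset_univ A)
  rw [contDiff_euclidean]
  exact fun j => (P j).contDiff_aeval 1

theorem theorem2p4 (k : ℕ) (hk : 1 ≤ k) (P : Fin k → ℚ[X])
    (hP : P ⟨0, hk⟩ = X)
    (d : Fin k → ℕ) (hd : ∀ j, d j = (P j).natDegree) (hmono : Monotone d)
    (ht : 1 ≤ tupleDiameter d)
    (τ : ℝ) (hτ : 1 / (k : ℝ) ≤ τ)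
    (r : Fin k) (hr : IsFirstBigJump d τ r)
    (e : Fin k) (he : (e : ℕ) + 1 = k)
    (lam : ℝ) (hlam : τ < lam) :
    (approxSet 1 ((d e : ℝ) * lam + (d e : ℝ) - 1) ⊆
        projFirst hk '' (polyCurve P ∩ approxSet k lam) ∧
      projFirst hk '' (polyCurve P ∩ approxSet k lam) ⊆
        approxSet 1 ((d r : ℝ) * lam + (d r : ℝ) - 1)) ∧
    (ENNReal.ofReal (2 / ((d e : ℝ) * (1 + lam))) ≤ dimH (polyCurve P ∩ approxSet k lam) ∧
      dimH (polyCurve P ∩ approxSet k lam) ≤ ENNReal.ofReal (2 / ((d r : ℝ) * (1 + lam)))) := by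
  have hτ0 : 0 < τ := lt_of_lt_of_le (by positivity) hτ
  have hlam0 : 0 < lam := hτ0.trans hlam
  have hd0 : d ⟨0, hk⟩ = 1 := by rw [hd, hP, natDegree_X]
  have hd1 : ∀ j, 1 ≤ d j := fun j => hd0 ▸ hmono (Fin.mk_le_mk.2 (Nat.zero_le _))
  have hde : ∀ j, d j ≤ d e := fun j => hmono (Fin.le_def.2 (by omega))
  -- A positive jump gives `d e ≥ 2`, which puts the exponent `d e * lam + d e - 1` above 1, as the
  -- Jarník–Besicovitch lower bound requires.
  have hde2 : 2 ≤ d e := by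
    obtain ⟨j, -, hj⟩ := (Finset.lt_sup_iff (a := 0)).1 (Nat.lt_of_succ_le ht)
    have h1 := hde ⟨(j : ℕ) + 1, by have := j.isLt; omega⟩
    have h2 := hd1 ⟨(j : ℕ), by have := j.isLt; omega⟩
    omega
  have hsmall : ∀ j, ∀ h : j + 1 < k, j < (r : ℕ) →
      (d ⟨j + 1, h⟩ : ℝ) - d ⟨j, by omega⟩ ≤ τ := by
    intro j h hjr
    by_contra! hcon
    have hmem : (⟨j, by omega⟩ : Fin k) ∈ bigJumps d τ := ⟨h, hcon⟩
    rcases hr with hr | ⟨hr, -⟩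
    · exact absurd (hr.2 hmem) (by rw [Fin.le_def]; simpa using hjr)
    · rw [hr] at hmem; exact hmem
  set γ : ℝ → EuclideanSpace ℝ (Fin k) :=
    fun x => WithLp.toLp 2 fun j : Fin k => aeval x (P j) with hγ
  have hlower : ∀ x ∈ approxLine (d e * lam + d e - 1), γ x ∈ polyCurve P ∩ approxSet k lam :=
    fun x hx => ⟨⟨x, rfl⟩, fun ε hε => infinite_simultaneous_of_mem_approxLine P (hd1 e)
      (fun j => hd j ▸ hde j) hlam0 hx hε⟩
  have hupper : ∀ x, γ x ∈ approxSet k lam → x ∈ approxLine (d r * lam + d r - 1) :=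
    fun x hx => mem_approxLine_of_infinite_simultaneous hk P hP d hd hmono hτ0 hlam r hsmall hx
  have hγ0 : ∀ x, γ x ⟨0, hk⟩ = x := fun x => by simp [hγ, hP]
  refine ⟨⟨fun ζ hζ => ⟨γ (ζ 0), hlower _ (mem_approxSet_one.1 hζ), ?_⟩, ?_⟩, ?_, ?_⟩
  · ext i
    rw [Subsingleton.elim i 0]
    exact hγ0 _
  · rintro _ ⟨_, ⟨⟨x, rfl⟩, hx⟩, rfl⟩
    rw [mem_approxSet_one]
    have : projFirst hk (γ x) 0 = x := hγ0 x
    change projFirst hk (γ x) 0 ∈ _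
    rw [this]
    exact hupper x hx
  · have hdim := le_dimH_approxLine (w := d e * lam + d e - 1) (by
      have : (2 : ℝ) ≤ d e := by exact_mod_cast hde2
      nlinarith)
    rw [show 1 + ((d e : ℝ) * lam + d e - 1) = d e * (1 + lam) by ring] at hdim
    refine hdim.trans ?_
    have hsub : approxLine (d e * lam + d e - 1) ⊆
        EuclideanSpace.proj (𝕜 := ℝ) (⟨0, hk⟩ : Fin k) '' (polyCurve P ∩ approxSet k lam) :=
      fun x hx => ⟨γ x, hlower x hx, hγ0 x⟩
    exact (dimH_mono hsub).trans
      ((EuclideanSpace.proj (𝕜 := ℝ) (⟨0, hk⟩ : Fin k)).lipschitz.dimH_image_le _)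
  · have hdr : (1 : ℝ) ≤ d r := by exact_mod_cast hd1 r
    have hdim := dimH_approxLine_le (w := d r * lam + d r - 1) (by nlinarith)
    rw [show 1 + ((d r : ℝ) * lam + d r - 1) = d r * (1 + lam) by ring] at hdim
    refine le_trans (dimH_mono ?_) ((dimH_image_polyCurve_le P _).trans hdim)
    rintro _ ⟨⟨x, rfl⟩, hx⟩
    exact ⟨x, hupper x hx, rfl⟩
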